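/- A Roman dominating function of a finite simple graph $G$ is a function $f\colon V(G)\to\{0,1,2\}$ such that every vertex $v$ with $f(v)=0$ is adjacent to at least one vertex $w$ with $f(w)=2$; its weight is $\sum_{v\in V(G)}f(v)$, and the Roman domination number $\gamma_R(G)$ is the minimum weight of a Roman dominating function of $G$. Let $P_8$ be the path with $8$ vertices, $C_n$ the cycle with $n$ vertices, and $P_8\Box C_n$ their Cartesian product. Then for every integer $n\ge 3$, $$\gamma_R(P_8\Box C_n)=\begin{cases}\left\lceil \frac{18n}{5}\right\rceil & \text{if } n\equiv 0 \pmod 5,\\[2pt] \left\lceil \frac{18n}{5}\right\rceil+1 & \text{if } n\equiv 2,3,4 \pmod 5 \text{ and } n\neq 3,\ \text{ or } n=6,\\[2pt] \left\lceil \frac{18n}{5}\right\rceil+2 & \text{otherwise (that is, } n\equiv 1 \pmod 5 \text{ with } n\neq 6,\ \text{ or } n=3).\end{cases}$$ -/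

import Mathlib

open scoped SimpleGraph

namespace SimpleGraph

variable {V : Type*}

/-- `f : V → {0, 1, 2}` is a Roman dominating function of `G`: every vertex of value `0` is
adjacent to at least one vertex of value `2`. -/
def IsRomanDominating (G : SimpleGraph V) (f : V → Fin 3) : Prop :=
  ∀ v, f v = 0 → ∃ w, G.Adj v w ∧ f w = 2

/-- The weight of `f : V → {0, 1, 2}`, the sum of its values in `ℕ`. -/
def romanWeight [Fintype V] (f : V → Fin 3) : ℕ :=
  ∑ v, (f v : ℕ)

/-- The Roman domination number: the minimum weight of a Roman dominating function. -/
noncomputable def romanDominationNumber [Fintype V] (G : SimpleGraph V) : ℕ :=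
  sInf {k | ∃ f : V → Fin 3, G.IsRomanDominating f ∧ romanWeight f = k}

/-- The infimum above is a genuine minimum. -/
theorem isLeast_romanDominationNumber [Fintype V] (G : SimpleGraph V) :
    IsLeast {k | ∃ f : V → Fin 3, G.IsRomanDominating f ∧ romanWeight f = k}
      G.romanDominationNumber :=
  ⟨Nat.sInf_mem ⟨_, fun _ => 1, fun _ h => absurd h (by simp), rfl⟩, fun _ hk => Nat.sInf_le hk⟩

end SimpleGraph

/-! Lower bound. Read a Roman dominating function column by column around the cycle and mark each
cell by what is known once its column and the previous one are seen. This gives a closed walk of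
length `n` in a finite graph of columns, and the weight W of the function is at least the cost of
the walk. Potentials on the columns, as in linear programming duality, bound this cost: if every
step satisfies `Q t + β ≤ A s + α * w`, summing along the walk telescopes.

One potential excludes only two columns, `hub` and its mirror image, and gives 4W ≥ 15n for walks
avoiding both. Otherwise rotate, and reflect if needed, so that the walk starts at `hub`. A
potential on all columns makes the excess 5W − 18n of every step nonnegative up to telescoping.
Tables indexed by the length modulo 5 record the walks from `hub` that stay less than 8 above this
potential; on return to `hub` only excess at least 0 for n ≡ 0 and at least 6 for n ≡ 3 survive, and
otherwise the excess is at least 8. As 5W − 18n ≡ 2n (mod 5), an excess of at least 8 rounds up to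
12, 9, 8 for n ≡ 1, 2, 4. This and the first bound give the theorem for n ≥ 5; the bound 15n/4
decides n = 6, and n = 3, 4 follow from inequalities between row sums (`row_three`, `row_four`).

Upper bound. A pattern of period 5 and weight 18 is spliced with a short explicit word for each
residue class (`IsClosedWord.prependBlocks`); n = 3 and n = 6 have words of their own. -/

namespace RomanCylinder

/-! ### Marks of cells and their costs -/

/-- The state of a cell once its own column and the previous one are known: it carries the value
`2` (`guard`), it is otherwise taken care of (`done`), or it still needs a guard in the next
column (`needs`). -/
inductive Mark
  | needs
  | done
  | guard
  deriving DecidableEq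

namespace Mark

def isGuard : Mark → Bool
  | guard => true
  | _ => false

/-- Which marks may stand next to each other in a column. -/
def compat : Mark → Mark → Bool
  | needs, guard => false
  | guard, needs => false
  | _, _ => true

/-- Which marks may follow each other in a row. -/
def follows : Mark → Mark → Bool
  | needs, guard => true
  | needs, _ => false
  | guard, needs => false
  | _, _ => true

/-- The least value of a cell marked `q`, between cells marked `p` and `r` in its column, and
preceded by a cell marked `x` in its row. -/
def cost (p q r x : Mark) : ℕ :=
  match q with
  | needs => 0
  | guard => 2
  | done => cond (x.isGuard || p.isGuard || r.isGuard) 0 1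

end Mark

/-! ### Tables over columns and the verification of potentials -/

/-- A table of natural numbers indexed by sequences of marks. -/
inductive Tree
  | leaf (v : ℕ)
  | node (a b c : Tree)

namespace Tree

noncomputable section

/-- A leaf above full depth is a constant table, hence its own child; `leaf 0` prunes a whole
subtree. -/
def child : Tree → Mark → Tree
  | leaf v, _ => leaf v
  | node a _ _, .needs => a
  | node _ b _, .done => b
  | node _ _ c, .guard => c

/-- The entry of a table; the value `0` stands for a missing entry. -/
def get : Tree → (ℕ → Mark) → ℕ
  | leaf v, _ => v
  | node a b c, s =>
    match s 0 with
    | .needs => a.get fun i => s (i + 1)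
    | .done => b.get fun i => s (i + 1)
    | .guard => c.get fun i => s (i + 1)

/-- Add `k` to every entry that is present. -/
def shift (k : ℕ) : Tree → Tree
  | leaf v => leaf (cond (v.beq 0) 0 (v + k))
  | node a b c => node (a.shift k) (b.shift k) (c.shift k)

/-- A lower bound for the entrywise minimum of `A`, shifted by `k`, and `B`. -/
def lowerMin (k : ℕ) (A : Tree) : Tree → Tree :=
  A.rec
    (fun a B => B.rec
      (fun b => leaf (cond (a.beq 0) b (cond (b.beq 0) (a + k) (cond ((a + k).ble b) (a + k) b))))
      fun b₁ b₂ b₃ _ _ _ => cond (a.beq 0) (node b₁ b₂ b₃) (leaf 1))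
    fun a₁ a₂ a₃ h₁ h₂ h₃ B => B.rec (fun b => cond (b.beq 0) ((node a₁ a₂ a₃).shift k) (leaf 1))
      fun b₁ b₂ b₃ _ _ _ => node (h₁ b₁) (h₂ b₂) (h₃ b₃)

/-- The entries of `E` where they are present, and those of `P`, shifted by `k`, elsewhere. -/
def overlay (k : ℕ) : Tree → Tree → Tree
  | leaf e, P => cond (e.beq 0) (P.shift k) (leaf e)
  | node _ _ _, leaf v => (leaf v).shift k
  | node e₁ e₂ e₃, node p₁ p₂ p₃ =>
    node (e₁.overlay k p₁) (e₂.overlay k p₂) (e₃.overlay k p₃)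

/-- Eliminate the first cell of the previous column from the table `A`. -/
def merge (α : ℕ) (p q r : Mark) (A : Tree) : Tree :=
  match q with
  | .needs => A.child .done
  | .guard => ((A.child .needs).lowerMin 0 (A.child .done)).lowerMin 0 (A.child .guard)
  | .done =>
    (A.child .done).lowerMin (cond (p.isGuard || r.isGuard) 0 α) (A.child .guard)

/-- The cost of a guard does not depend on the previous column, so it goes into an accumulator
instead of being added to every entry of a merged table. -/
def surcharge (α : ℕ) : Mark → ℕ
  | .guard => 2 * α
  | _ => 0

def isMissing : Tree → Bool
  | leaf v => v.beq 0
  | _ => false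

/-- Checks, for all columns `s` in `A` and all columns `t` that may follow it and continue
`p`, `q`, that the entry of `t` in `Q` plus `β` is at most the entry of `s` in `A` plus `acc` plus
`α` times the cost of the transition. -/
def check (α β : ℕ) : ℕ → Mark → Mark → ℕ → Tree → Tree → Bool
  | 0, p, q, acc, A, Q =>
    -- The last cell has the border mark `done` below it.
    match merge α p q .done A, Q with
    | leaf a, leaf b => a.beq 0 || (b + β).ble (a + (acc + surcharge α q))
    | _, _ => false
  | k + 1, p, q, acc, A, Q =>
    let step (r : Mark) : Bool :=
      !q.compat r || (merge α p q r A).isMissing ||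
        check α β k q r (acc + surcharge α q) (merge α p q r A) (Q.child r)
    step .needs && step .done && step .guard

/-- A cell is charged only when the mark below it is known, so the first mark is chosen here, under
the border `done`, and 7 marks remain. -/
def checkStep (α β : ℕ) (A Q : Tree) : Bool :=
  check α β 7 .done .needs 0 A (Q.child .needs) && check α β 7 .done .done 0 A (Q.child .done) &&
    check α β 7 .done .guard 0 A (Q.child .guard)

/-- The columns of length `k`, below the mark `p`, that are missing from a table. -/
def missing : ℕ → Mark → Tree → List (List Mark)
  | 0, _, leaf v => if v = 0 then [[]] else []
  | 0, _, node _ _ _ => [[]]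
  | k + 1, p, T =>
    let step (q : Mark) : List (List Mark) :=
      if p.compat q then (missing k q (T.child q)).map (q :: ·) else []
    step .needs ++ step .done ++ step .guard

/-- The number of columns of length `k` below a mark `needs` or `guard`, and below `done`. -/
def columnCount : ℕ → ℕ × ℕ
  | 0 => (1, 1)
  | k + 1 => ((columnCount k).1 + (columnCount k).2, 2 * (columnCount k).1 + (columnCount k).2)

/-- The table whose entries, in lexicographic order, are the digits of `N` in base `2 ^ b`. -/
def ofDigits (b : ℕ) : ℕ → Mark → ℕ → Tree
  | 0, _, N => leaf N
  | k + 1, p, N =>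
    let x := b * (columnCount k).1
    let y := b * (columnCount k).2
    match p with
    | .needs => node (ofDigits b k .needs (N % 2 ^ x)) (ofDigits b k .done (N >>> x)) (leaf 0)
    | .guard => node (leaf 0) (ofDigits b k .done (N % 2 ^ y)) (ofDigits b k .guard (N >>> y))
    | .done => node (ofDigits b k .needs (N % 2 ^ x)) (ofDigits b k .done ((N >>> x) % 2 ^ y))
        (ofDigits b k .guard ((N >>> x) >>> y))

/-- The table with the single entry `v` at the column with the base `3` digits of `N`. -/
def single (v : ℕ) : ℕ → ℕ → Tree
  | 0, _ => leaf v
  | k + 1, N =>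
    match N / 3 ^ k with
    | 0 => node (single v k (N % 3 ^ k)) (leaf 0) (leaf 0)
    | 1 => node (leaf 0) (single v k (N % 3 ^ k)) (leaf 0)
    | _ => node (leaf 0) (leaf 0) (single v k (N % 3 ^ k))

def ofEntries (l : List (ℕ × ℕ)) : Tree :=
  l.foldr (fun e T => (single e.2 8 e.1).lowerMin 0 T) (leaf 0)

end

end Tree

/-! ### The certificates -/

def ofChunks (l : List ℕ) : ℕ :=
  l.foldr (fun x N => x + N <<< 320) 0

/-- A potential for walks avoiding the two missing columns. -/
noncomputable def avoidingPotential : Tree := .ofDigits 5 8 .done <| ofChunks [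
  0x8c62d6a6f37bd7584e0f7adef5ad316bdeb59d6b39cb98c5a9ab6306b52d6a5258a5ad4a4a9494a1,
  0xdde707de338420d7c1ad5d611835a97b52b4e2726366d7c1ad4ada949e2c6b5292b525417f9bd639,
  0x6c20d6258d4a8f26b189415a92a4bfff799ee338ad23fcde91cc694841918b5a9ee2f49d6118358c,
  0x7c1ad5d610835898b52c4fad694ad2939ae6e6b38beb1a42106c20d6ae2d841ac4b5a94a732939b2,
  0x9ca91836516b9bfd6ad6cd2b28c21dcde93cd6f0842138420fac690841b1835ade56d08da338420d,
  0xcda548ffded67b8cda548ff37a4753b5e737ca6f7af31a52306c62d6a7fef6b5dce6d2ad7d7b4a59,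
  0x7460d6a5ce5293ba4e0d9b5f06b96b6a547a35ef62d0d6a525ffffff7fbeeeb39fffd8cfb3ad5af3,
  0x9418e6e2947c2f19c2106be0c6ae908418d4c1885a7f8cde98a4e4e7b7549c9f68ce10835f06b972,
  0xff779f6737ace9fd6694d529484193939edff377be695a4210e62f39eab7842109c2107da548420d,
  0xb4a328f717acf35bc21084e1083eb1a42106c60d6b7b6b4a368ce10835f06b9768c20d6262d4b53f,
  0xe6ef7ee3108421784210cd7108421584210e6313a6ab7842109c2107e2948420da418f6ff5ab5b56,
  0xbde9384eb193f149ce0f6524e837ffffbbfef756be3fbd5addb5ad2a42d274a3ff7b5aee336a529f,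
  0x8b5cdcc694841918b5a9fffffffffff6b7cfffdbd7f5ad5af4d5a57aff9dde398c5a54a7f19a5354,
  0xc6294866d2a47feeeb3dc66d3a47b8bd279a6715ac6b58c615056b18b6316b5bfce691c82b58ca11,
  0xd5b19ffffffffdeddf59fffd8cfb1be6717be2b49f738c5693cda548ffffff7feef739c7fddc63b8,
  0x9cdef5c9ec5b7f9cd2398dab193e516b9798d291836316b53ffffffffffff7ffffff9effbded731e,
  0x9c1f1e6313a6ab6c52919d2117e292a420da418f6ffded67d9cda538faf69cb55bde737ce707bed1,
  0xfffdfefbb9ce7fef633ece735ac73694e3ff7b5aee3369529fdeaf6f6758bde77bd273d56d79cdf6,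
  0xffbbdffffdf7fbef6b77f6ad9bfffff7bfdf6ad9bffdecdfd7d6ef79daf39bfd9c62d4966d29c7ff,
  0xf6b5fcfbb9d5f59adabdceb56bcf3694ebfefb19ed759adab6ac651f6718ad239b4a91ffffffffff,
  0xff79bf773abfffce7318ff73bcffffffffffffbeeffffe77fdef739afb56c67fffffdfefbb9d67fe,
  0x1fffffffffffffffffffffffffffffbfffbffffffffffffffbffffffffffbf]

/-- A potential for all walks. -/
noncomputable def potential : Tree := .ofDigits 6 8 .done <| ofChunks [
  0x638e38dd8d97dd69941e75e65864f6184cf26176171879d7196193d75523c865665441129038b281,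
  0xf8d97dd6994289288dfa248e37e365f7da6508de8de69951a55550ba27a238a79e38e28d9a23a238,
  0x9ed8f2b72b69b6db6d92d8e99248dabaaba9a6aa69a24a20b68b68929a29a24a1ea6491f6a89688d,
  0x247daa25a238605df79a650ae6ae686792685f85785f7174a182171a6d26965512f2b72b69b6db6d,
  0xbc2ba6da6ba24a1fa6491f6a89688df8197db699430b30aebb6cae89e8870b2daebae8a689a88699,
  0xbeeba9b63baea657f3bf3baebefbaaa6a930bf0aebbefbaaa6a86ea6991fbefb6a96a82595f816c2,
  0x33cefbafa73bf3baecefceebad933baea64befbaaa6a82996481ad74d70bb4c70becbe5cafcaeaef,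
  0x15e17dc5d286085c5db457592448e34e33cf4cf3caeca9df2df2c33cb3caeca8ceeba9938d38cf3d,
  0x650c2cc2b9efb2ba27a20b6ab689aaa28a22a1e9a485e5e696685f8167dd69642b9ab9a19e29a176,
  0xadaf1beeb69b65baaa6582fbedaa5aa09657e05b1b30ae7c6cb289e8827921797a25a237e065f6da,
  0x685d75475d6143b7d37cafdb2cb2b32ab7cb7caecb2cb2a72a2eaa9a20d74d70bf1bf0beabeacafc,
  0xc71c6d9f2c72b6cc71b6db2d8ecb278ddb6cb689e77a79e2798c2cc2b9ecb2b9e799d9a485c5e68a,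
  0x6eb29960befb6a9ea8279e2818d70d70af1b30ae7ae1ae79a172b9ab9a185b85e7194b6db5c71db6,
  0xadf6df2c76db2cb1caadf2df2bb2cb2cacca8baea68836db5c71db6c71c6fab5c75c2cc71c2db2d9,
  0xc33cb3caeca8ceeba9938db8cf3db6cf1c6fab5c75c2ecf1ceebad973baea64cafcada6a829a248d,
  0xeabe5aaa9256f6c75c2cdb1c6db2d8eca668dcb6ab689257a489f795eb6eb5cf7db5cb1caadf2df2,
  0x4c74ab7d37cf0db4cf3b32a33cebaa4db6d71c76db1c71beadb4d70b36d31becbe5baea65834d30b,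
  0xceeb64eb6eb5cf6db5cb1cabdf4df2c36d33caeca8cf1ba9934d32becbe5b2c9e577ae7ad71e76d7,
  0x2cc2b9ecb2b9e799d9a485c5e696685f8177dd69643cefcdf6efbdf7db7b7cdfcdf5df7df7c77b73,
  0xaf0ae69a09a385e5f6db5c71db6c71c6f9f5c72c30c71badb2d9aeb2995fbefb6a9ea8279e2818c,
  0xdb6d71c70abad7ad70d74d70b309b0b2b9a1d34cafaaf96aaa495beb5eb5c35c75c2cc26c2cae687,
  0xb2ab3beeaa5df4df2baf96eb69a1feb9eb5c79db5d31d2aeb5eb5c35d35cacca8c2faea87adbad71,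
  0x1817ffbffadbcefadf6deff37f37d77df7df1dedd73c2d9bae7ad74df6df4c74bfad7ad70df4df2b,
  0xeb5c39e75d2fd2acefbaa939e75d2fd2abefa6a83ad7ad70db1d70b309b0b2b9a1c2fc2b9aa82696,
  0x77d2fd2abefa6a83ffbfeb5fb9eb9d39bfae7ad75e79d74c34af5d30be6eb9eb5cf9e75d31d2aeb9,
  0xbeb9db9bfce7cdf5e79e37cf7b78d33be9f79f78e39e78d33d2feb9eb5cf9e78d33d2ae33ceea79e,
  0x3ffbfeb8fb]

/-- The entries below `potential + 8` of the least excess, by length modulo `5`, of a walk from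
the column `hub`. -/
noncomputable def improvements : ℕ → Tree := fun r => .ofEntries <|
  match r with
  | 0 => [(1069, 52), (1164, 47), (1165, 52), (1328, 57), (3979, 52), (3985, 52), (3986, 57),
      (4012, 57), (6172, 62)]
  | 1 => [(876, 44), (3063, 49), (3064, 54), (3067, 59), (3306, 54), (4035, 54), (5232, 54),
      (5250, 54), (5395, 59), (5477, 64)]
  | 2 => [(1326, 51), (1328, 51), (1337, 56), (2629, 56), (3497, 56), (3515, 56), (5702, 56),
      (5711, 61)]
  | 3 => [(2479, 48), (2575, 53), (3208, 53), (3985, 58), (5395, 53), (5396, 63), (5476, 58)]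
  | _ => [(442, 50), (2628, 45), (2629, 50), (2632, 55), (2633, 55), (2635, 55), (3063, 55),
      (3358, 55), (3931, 55), (4087, 55)]

/-! ### Soundness of the table operations -/

namespace Tree

theorem beq_succ_zero (n : ℕ) : (n + 1).beq 0 = false := rfl

theorem get_eq_get_child (T : Tree) (s : ℕ → Mark) :
    T.get s = (T.child (s 0)).get fun i => s (i + 1) := by
  cases T with
  | leaf v => rfl
  | node a b c => cases h : s 0 <;> simp [get, child, h]

theorem get_node (a b c : Tree) (s : ℕ → Mark) :
    (node a b c).get s = ((node a b c).child (s 0)).get fun i => s (i + 1) :=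
  get_eq_get_child _ _

theorem get_shift (k : ℕ) (T : Tree) (s : ℕ → Mark) :
    (T.shift k).get s = if T.get s = 0 then 0 else T.get s + k := by
  induction T generalizing s with
  | leaf v => rcases v with _ | v <;> simp [shift, get, beq_succ_zero]
  | node a b c ha hb hc =>
    simp only [shift]
    rw [get_node, get_node]
    cases s 0
    · exact ha _
    · exact hb _
    · exact hc _

theorem get_lowerMin (k : ℕ) (A B : Tree) (s : ℕ → Mark) :
    (A.get s ≠ 0 → (A.lowerMin k B).get s ≠ 0 ∧ (A.lowerMin k B).get s ≤ A.get s + k) ∧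
      (B.get s ≠ 0 → (A.lowerMin k B).get s ≠ 0 ∧ (A.lowerMin k B).get s ≤ B.get s) := by
  induction A generalizing B s with
  | leaf a =>
    cases B with
    | leaf b =>
      change (a ≠ 0 → cond _ _ _ ≠ 0 ∧ cond _ _ _ ≤ a + k) ∧
        (b ≠ 0 → cond (a.beq 0) b (cond (b.beq 0) (a + k)
          (cond ((a + k).ble b) (a + k) b)) ≠ 0 ∧ cond _ _ _ ≤ b)
      rcases a with _ | a
      · simp
      rcases b with _ | b
      · simp [beq_succ_zero]
      simp only [beq_succ_zero, cond_false]
      cases h : (a + 1 + k).ble (b + 1)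
      · have : ¬ (a + 1 + k ≤ b + 1) := fun h' => by simp [Nat.ble_eq_true_of_le h'] at h
        simp only [cond_false]; omega
      · have := Nat.le_of_ble_eq_true h
        simp only [cond_true]; omega
    | node b₁ b₂ b₃ =>
      change (a ≠ 0 → (cond (a.beq 0) (node b₁ b₂ b₃) (leaf 1)).get s ≠ 0 ∧
        (cond (a.beq 0) (node b₁ b₂ b₃) (leaf 1)).get s ≤ a + k) ∧ (_ →
        (cond (a.beq 0) (node b₁ b₂ b₃) (leaf 1)).get s ≠ 0 ∧
        (cond (a.beq 0) (node b₁ b₂ b₃) (leaf 1)).get s ≤ (node b₁ b₂ b₃).get s)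
      rcases a with _ | a
      · simp
      -- Tables of different shapes are bounded by the constant 1, which is below every present
      -- entry.
      · simp only [Nat.beq, cond_false, get]
        omega
  | node a₁ a₂ a₃ h₁ h₂ h₃ =>
    cases B with
    | leaf b =>
      change (_ → (cond (b.beq 0) ((node a₁ a₂ a₃).shift k) (leaf 1)).get s ≠ 0 ∧
        (cond (b.beq 0) ((node a₁ a₂ a₃).shift k) (leaf 1)).get s ≤ _) ∧ (b ≠ 0 →
        (cond (b.beq 0) ((node a₁ a₂ a₃).shift k) (leaf 1)).get s ≠ 0 ∧
        (cond (b.beq 0) ((node a₁ a₂ a₃).shift k) (leaf 1)).get s ≤ b)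
      rcases b with _ | b
      · simp only [Nat.beq, cond_true, get_shift]
        split_ifs <;> omega
      · simp only [Nat.beq, cond_false, get]
        omega
    | node b₁ b₂ b₃ =>
      have h : (node a₁ a₂ a₃).lowerMin k (node b₁ b₂ b₃) =
        node (a₁.lowerMin k b₁) (a₂.lowerMin k b₂) (a₃.lowerMin k b₃) := rfl
      rw [h, get_node, get_node, get_node]
      cases s 0
      · exact h₁ _ _
      · exact h₂ _ _
      · exact h₃ _ _

theorem get_overlay (k : ℕ) (E P : Tree) (s : ℕ → Mark) :
    (E.overlay k P).get s = (P.shift k).get s ∨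
      E.get s ≠ 0 ∧ (E.overlay k P).get s = E.get s := by
  induction E generalizing P s with
  | leaf e =>
    rcases e with _ | e
    · left; simp [overlay]
    · right; simp [overlay, get, beq_succ_zero]
  | node e₁ e₂ e₃ h₁ h₂ h₃ =>
    cases P with
    | leaf v => left; rfl
    | node p₁ p₂ p₃ =>
      simp only [overlay, shift]
      rw [get_node, get_node, get_node]
      cases s 0
      · exact h₁ _ _
      · exact h₂ _ _
      · exact h₃ _ _

/-- For each mark `q`, `merge` takes the minimum over exactly the marks that `q` may follow, with
the cost of the cell added, except for the guard cost, which is the surcharge. -/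
theorem get_merge (α : ℕ) {p q r : Mark} (A : Tree) (s : ℕ → Mark) (hf : (s 0).follows q = true)
    (hA : A.get s ≠ 0) (hp : p.compat q = true) (hr : q.compat r = true) :
    (merge α p q r A).get (fun i => s (i + 1)) ≠ 0 ∧
      (merge α p q r A).get (fun i => s (i + 1)) + surcharge α q ≤
        A.get s + α * p.cost q r (s 0) := by
  rw [get_eq_get_child A] at hA ⊢
  set s' : ℕ → Mark := fun i => s (i + 1)
  cases q with
  | needs =>
    cases h : s 0 <;> simp_all [merge, surcharge, Mark.follows]
  | guard =>
    have h₁ := get_lowerMin 0 (A.child .needs) (A.child .done) s'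
    have h₂ := get_lowerMin 0 ((A.child .needs).lowerMin 0 (A.child .done)) (A.child .guard) s'
    simp only [merge, surcharge, Mark.cost]
    cases h : s 0 <;> rw [h] at hA
    · have h₃ := h₁.1 hA; have := h₂.1 h₃.1; omega
    · have h₃ := h₁.2 hA; have := h₂.1 h₃.1; omega
    · have := h₂.2 hA; omega
  | done =>
    have h₁ := get_lowerMin (cond (p.isGuard || r.isGuard) 0 α) (A.child .done) (A.child .guard) s'
    simp only [merge, surcharge, Mark.cost]
    cases h : s 0 <;> rw [h] at hA
    · simp [h, Mark.follows] at hf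
    · have := h₁.1 hA
      have hd : Mark.done.isGuard = false := rfl
      rw [hd, Bool.false_or]
      cases h' : (p.isGuard || r.isGuard) <;> simp only [h', cond_true, cond_false] at this ⊢ <;>
        omega
    · have := h₁.2 hA
      have hd : Mark.guard.isGuard = true := rfl
      simp only [hd, Bool.true_or, cond_true]
      omega

theorem get_of_isMissing {T : Tree} (h : T.isMissing = true) (s : ℕ → Mark) : T.get s = 0 := by
  cases T with
  | leaf v => rcases v with _ | v <;> simp_all [isMissing, get]
  | node => simp [isMissing] at h

open Finset in
-- Dynamic programming cell by cell: `get_merge` trades the first cell of `s` for its cost, and the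
-- remaining cells satisfy the same statement for the merged table.
theorem le_of_check {α β : ℕ} {k : ℕ} {acc : ℕ} {A Q : Tree} {s t : ℕ → Mark}
    (h : check α β k (t 0) (t 1) acc A Q = true) (ht : t (k + 2) = .done)
    (hf : ∀ i ≤ k, (s i).follows (t (i + 1)) = true)
    (hc : ∀ i ≤ k + 1, (t i).compat (t (i + 1)) = true) (hA : A.get s ≠ 0) :
    Q.get (fun i => t (i + 2)) + β ≤ A.get s + acc +
      α * ∑ i ∈ range (k + 1), (t i).cost (t (i + 1)) (t (i + 2)) (s i) := by
  induction k generalizing acc A Q s t with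
  | zero =>
    have hm := get_merge α (r := .done) A s (hf 0 le_rfl) hA (hc 0 (by simp))
      (by simpa [ht] using hc 1 le_rfl)
    simp only [check] at h
    cases hM : merge α (t 0) (t 1) .done A with
    | node => simp [hM] at h
    | leaf a =>
      cases hQ : Q with
      | node => simp [hM, hQ] at h
      | leaf b =>
        simp only [hM, hQ, Bool.or_eq_true, Nat.ble_eq] at h
        simp only [hM, get] at hm
        simp only [get, zero_add, sum_range_one]
        simp only [zero_add] at ht hm
        rw [ht]
        have := h.resolve_left fun h' => hm.1 (Nat.eq_of_beq_eq_true h')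
        omega
  | succ k ih =>
    simp only [check, Bool.and_eq_true, Bool.or_eq_true] at h
    have hm := get_merge α A s (hf 0 (by simp)) hA (hc 0 (by simp)) (hc 1 (by simp))
    have h' : ((merge α (t 0) (t 1) (t 2) A).isMissing = true ∨
        check α β k (t 1) (t 2) (acc + surcharge α (t 1)) (merge α (t 0) (t 1) (t 2) A)
          (Q.child (t 2)) = true) := by
      have hc1 := hc 1 (by simp)
      obtain ⟨⟨h₁, h₂⟩, h₃⟩ := h
      cases h2 : t 2 <;> simp_all
    rcases h' with h' | h'
    · exact absurd (get_of_isMissing h' _) hm.1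
    · have := ih (t := fun i => t (i + 1)) (s := fun i => s (i + 1)) h' ht
        (fun i hi => hf (i + 1) (by omega)) (fun i hi => hc (i + 1) (by omega)) hm.1
      rw [sum_range_succ', get_eq_get_child Q, mul_add]
      simp only [zero_add, add_assoc, Nat.reduceAdd] at this hm ⊢
      omega

end Tree

/-! ### Transitions between columns -/

open Finset in
/-- `Transition s t w`: the column `t` of weight `w` may follow the column `s`. Columns have rows
`1, …, 8`, with a border of marks `done`. -/
structure Transition (s t : ℕ → Mark) (w : ℕ) : Prop where
  compat : ∀ i, (t i).compat (t (i + 1)) = true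
  zero : t 0 = .done
  nine : t 9 = .done
  follows : ∀ i < 8, (s (i + 1)).follows (t (i + 1)) = true
  cost_le : ∑ i ∈ range 8, (t i).cost (t (i + 1)) (t (i + 2)) (s (i + 1)) ≤ w

/-- The entry of a table at a column with border. -/
def Tree.entry (T : Tree) (t : ℕ → Mark) : ℕ := T.get fun i => t (i + 1)

theorem Transition.entry_le {s t : ℕ → Mark} {w α β : ℕ} (h : Transition s t w) {A Q : Tree}
    (hA : A.entry s ≠ 0) (hc : A.checkStep α β Q = true) :
    Q.entry t + β ≤ A.entry s + α * w := by
  have h' : Tree.check α β 7 (t 0) (t 1) 0 A (Q.child (t 1)) = true := by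
    simp only [Tree.checkStep, Bool.and_eq_true] at hc
    rw [h.zero]
    cases t 1 <;> tauto
  have := Tree.le_of_check (s := fun i => s (i + 1)) h' h.nine
    (fun i hi => h.follows i (by omega)) (fun i _ => h.compat i) hA
  have h₂ := Nat.mul_le_mul_left α h.cost_le
  rw [Tree.entry, Tree.get_eq_get_child]
  simp only [Tree.entry, zero_add, add_assoc, Nat.reduceAdd] at this ⊢
  omega

theorem Tree.mem_missing {k : ℕ} {T : Tree} {t : ℕ → Mark}
    (hc : ∀ i, (t i).compat (t (i + 1)) = true) (h : T.entry t = 0) :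
    ((List.range k).map fun i => t (i + 1)) ∈ missing k (t 0) T := by
  induction k generalizing T t with
  | zero => cases T <;> simp_all [missing, entry, get]
  | succ k ih =>
    rw [entry, get_eq_get_child] at h
    have := ih (T := T.child (t 1)) (t := fun i => t (i + 1)) (fun i => hc (i + 1)) h
    have h0 := hc 0
    rw [List.range_succ_eq_map]
    simp only [missing, List.map_cons, List.map_map, List.mem_append]
    cases h1 : t 1 <;> simp_all [Function.comp_def]

/-! ### The hub and the verified certificates -/

/-- A column through which the optimal periodic pattern passes, with border. -/
def hub : ℕ → Mark
  | 2 => .guard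
  | 5 => .needs
  | 7 => .guard
  | _ => .done

theorem hub_of_nine_le {i : ℕ} (hi : 9 ≤ i) : hub i = .done := by
  unfold hub
  split <;> first | omega | rfl

theorem avoidingPotential_checkStep :
    avoidingPotential.checkStep 4 15 avoidingPotential = true := by
  decide +kernel

theorem missing_avoidingPotential : avoidingPotential.missing 8 .done =
    [(List.range 8).map fun i => hub (8 - i), (List.range 8).map fun i => hub (i + 1)] := by
  decide +kernel

theorem potential_checkStep : potential.checkStep 5 18 potential = true := by
  decide +kernel

theorem missing_potential : potential.missing 8 .done = [] := by
  decide +kernel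

theorem improvements_checkStep : ∀ r < 5, (improvements r).checkStep 5 18
    ((improvements ((r + 1) % 5)).overlay 8 potential) = true := by
  decide +kernel

theorem potential_entry_hub : potential.entry hub = 52 := by decide +kernel

theorem improvements_entry_hub {r : ℕ} (hr : r < 5) : (improvements r).entry hub =
    if r = 0 then 52 else if r = 3 then 58 else 0 := by
  revert r
  decide +kernel

theorem potential_entry_ne_zero {t : ℕ → Mark} (h0 : t 0 = .done)
    (hc : ∀ i, (t i).compat (t (i + 1)) = true) : potential.entry t ≠ 0 := by
  intro h
  have := Tree.mem_missing (k := 8) hc h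
  rw [h0, missing_potential] at this
  simp at this

theorem eq_hub_of_avoidingPotential_entry_eq_zero {t : ℕ → Mark} (h0 : t 0 = .done)
    (h9 : ∀ i, 9 ≤ i → t i = .done) (hc : ∀ i, (t i).compat (t (i + 1)) = true)
    (h : avoidingPotential.entry t = 0) : t = hub ∨ t = fun i => hub (9 - i) := by
  have := Tree.mem_missing (k := 8) hc h
  rw [h0, missing_avoidingPotential, List.mem_cons, List.mem_singleton] at this
  have key : ∀ u : ℕ → Mark, u 0 = .done → (∀ i, 9 ≤ i → u i = .done) →
      ((List.range 8).map (fun i => t (i + 1)) = (List.range 8).map fun i => u (i + 1)) → t = u := by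
    intro u hu0 hu9 hu
    funext i
    rcases i with _ | i
    · rw [h0, hu0]
    · by_cases hi : i < 8
      · exact List.map_inj_left.1 hu i (List.mem_range.2 hi)
      · rw [h9 _ (by omega), hu9 _ (by omega)]
  rcases this with h | h
  · refine Or.inr (key _ rfl ?_ ?_)
    · intro i hi
      rw [Nat.sub_eq_zero_of_le hi]; rfl
    · simpa using h
  · refine Or.inl (key _ rfl (fun i => hub_of_nine_le) h)

open Finset

/-! ### Bounds along closed walks -/

theorem fifteen_mul_le {c : ℕ → ℕ → Mark} {w : ℕ → ℕ} (h : ∀ j, Transition (c j) (c (j + 1)) (w j))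
    (hc : ∀ j, avoidingPotential.entry (c j) ≠ 0) {n : ℕ} (hn : c n = c 0) :
    15 * n ≤ 4 * ∑ j ∈ range n, w j := by
  have key : ∀ n, avoidingPotential.entry (c n) + 15 * n ≤
      avoidingPotential.entry (c 0) + 4 * ∑ j ∈ range n, w j := by
    intro n
    induction n with
    | zero => simp
    | succ n ih =>
      have := (h n).entry_le (hc n) avoidingPotential_checkStep
      rw [sum_range_succ]
      omega
  have := key n
  rw [hn] at this
  omega

/-- The entry at the current column, with `potential` raised by 8 wherever `improvements` has no
entry, is at most 52 plus the excess so far, where 52 is the entry of `hub`. On return to `hub` the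
entry is 52, 58 or at least 60. -/
theorem excess_of_hub {c : ℕ → ℕ → Mark} {w : ℕ → ℕ} (h : ∀ j, Transition (c j) (c (j + 1)) (w j))
    (h0 : c 0 = hub) (hcompat : ∀ i, (hub i).compat (hub (i + 1)) = true) {n : ℕ} (hn : c n = hub) :
    18 * n + 8 ≤ 5 * ∑ j ∈ range n, w j ∨ n % 5 = 0 ∧ 18 * n ≤ 5 * ∑ j ∈ range n, w j ∨
      n % 5 = 3 ∧ 18 * n + 6 ≤ 5 * ∑ j ∈ range n, w j := by
  have hP : ∀ j, potential.entry (c j) ≠ 0 := by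
    intro j
    cases j with
    | zero => rw [h0]; exact potential_entry_ne_zero rfl hcompat
    | succ j => exact potential_entry_ne_zero (h j).zero (h j).compat
  have key : ∀ n, potential.entry (c n) + 8 + 18 * n ≤ 52 + 5 * ∑ j ∈ range n, w j ∨
      (improvements (n % 5)).entry (c n) ≠ 0 ∧
        (improvements (n % 5)).entry (c n) + 18 * n ≤ 52 + 5 * ∑ j ∈ range n, w j := by
    intro n
    induction n with
    | zero => right; rw [h0, improvements_entry_hub (by simp)]; simp
    | succ n ih =>
      rw [sum_range_succ]
      rcases ih with ih | ⟨ih₁, ih₂⟩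
      · have := (h n).entry_le (hP n) potential_checkStep
        omega
      -- The step lands in the overlay: either a recorded improvement persists, or the walk has
      -- reached `potential + 8` and stays above it from then on.
      · have h₁ := (h n).entry_le ih₁ (improvements_checkStep _ (Nat.mod_lt n (by simp)))
        rw [Nat.mod_add_mod] at h₁
        have h₂ := Tree.get_overlay 8 (improvements ((n + 1) % 5)) potential
          fun i => c (n + 1) (i + 1)
        have h₃ := hP (n + 1)
        simp only [Tree.get_shift] at h₂
        simp only [Tree.entry] at h₁ h₃ ih₂ ⊢
        rw [if_neg h₃] at h₂
        omega
  have := key n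
  rw [hn, potential_entry_hub, improvements_entry_hub (Nat.mod_lt n (by simp))] at this
  have := Nat.mod_lt n (show 5 > 0 by simp)
  split_ifs at * <;> omega

/-! ### From Roman dominating functions to walks of columns -/

/-- The values of a Roman dominating function on the cylinder, as a function of a row, from `1` to
`8`, and of a column in the universal cover, with a border of zeros. -/
structure IsUnrolled (n : ℕ) (g : ℕ → ℕ → ℕ) : Prop where
  border : ∀ i j, i = 0 ∨ 9 ≤ i → g i j = 0
  le_two : ∀ i j, g i j ≤ 2
  dominated : ∀ i j, i < 8 → g (i + 1) (j + 1) = 0 →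
    g i (j + 1) = 2 ∨ g (i + 2) (j + 1) = 2 ∨ g (i + 1) j = 2 ∨ g (i + 1) (j + 2) = 2
  periodic : ∀ i j, g i (j + n) = g i j

/-- The mark of the cell in row `i` and column `j + 1`. -/
def mark (g : ℕ → ℕ → ℕ) (j : ℕ) : ℕ → Mark
  | 0 => .done
  | i + 1 =>
    if 8 ≤ i then .done
    else if g (i + 1) (j + 1) = 2 then .guard
    else if g (i + 1) (j + 1) = 1 ∨ g i (j + 1) = 2 ∨ g (i + 2) (j + 1) = 2 ∨ g (i + 1) j = 2 then
      .done
    else .needs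

def columnWeight (g : ℕ → ℕ → ℕ) (j : ℕ) : ℕ := ∑ i ∈ range 8, g (i + 1) j

namespace IsUnrolled

variable {n : ℕ} {g : ℕ → ℕ → ℕ}

theorem mark_eq_guard (h : IsUnrolled n g) (i j : ℕ) : mark g j i = .guard ↔ g i (j + 1) = 2 := by
  rcases i with _ | i
  · simp [mark, h.border]
  · have := h.border (i + 1) (j + 1)
    simp only [mark]
    split_ifs <;> simp_all

theorem mark_eq_needs (h : IsUnrolled n g) (i j : ℕ) (hm : mark g j (i + 1) = .needs) :
    i < 8 ∧ g (i + 1) (j + 1) = 0 ∧ g i (j + 1) ≠ 2 ∧ g (i + 2) (j + 1) ≠ 2 ∧ g (i + 1) j ≠ 2 := by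
  simp only [mark] at hm
  have := h.le_two (i + 1) (j + 1)
  split_ifs at hm
  omega

theorem compat_mark (h : IsUnrolled n g) (i j : ℕ) :
    (mark g j i).compat (mark g j (i + 1)) = true := by
  cases h₁ : mark g j i <;> cases h₂ : mark g j (i + 1) <;> try rfl
  · rcases i with _ | i
    · simp [mark] at h₁
    · have := h.mark_eq_needs _ _ h₁
      rw [h.mark_eq_guard] at h₂
      exact absurd h₂ this.2.2.2.1
  · have := h.mark_eq_needs _ _ h₂
    rw [h.mark_eq_guard] at h₁
    exact absurd h₁ this.2.2.1

/-- A cell in need has no guard in its own or the previous column, so domination forces one in the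
next. The weight is that of column `j + 2` because `mark g (j + 1)` describes that column. -/
theorem transition (h : IsUnrolled n g) (j : ℕ) :
    Transition (mark g j) (mark g (j + 1)) (columnWeight g (j + 2)) where
  compat i := h.compat_mark i (j + 1)
  zero := rfl
  nine := rfl
  follows i hi := by
    have hg := h.mark_eq_guard (i + 1) (j + 1)
    cases h₁ : mark g j (i + 1) <;> cases h₂ : mark g (j + 1) (i + 1) <;> try rfl
    all_goals exfalso
    · have h₃ := h.mark_eq_needs _ _ h₁
      have h₄ := h.dominated i j hi
      rw [h₂] at hg
      tauto
    · have h₃ := h.mark_eq_needs _ _ h₁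
      have h₄ := h.dominated i j hi
      rw [h₂] at hg
      tauto
    · have h₅ := h.mark_eq_needs _ _ h₂
      rw [h.mark_eq_guard] at h₁
      exact h₅.2.2.2.2 h₁
  cost_le := by
    refine sum_le_sum fun i hi => ?_
    have h₁ := h.mark_eq_guard (i + 1) (j + 1)
    have h₂ := h.mark_eq_guard (i + 1) j
    have h₃ := h.mark_eq_guard i (j + 1)
    have h₄ := h.mark_eq_guard (i + 2) (j + 1)
    have hle := h.le_two (i + 1) (j + 2)
    cases h₅ : mark g (j + 1) (i + 1)
    · simp [Mark.cost]
    · simp only [Mark.cost]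
      by_cases h₆ : mark g j (i + 1) = .guard ∨ mark g (j + 1) i = .guard ∨
          mark g (j + 1) (i + 2) = .guard
      · rcases h₆ with h₆ | h₆ | h₆ <;> simp [h₆, Mark.isGuard]
      · simp only [mark] at h₅
        rw [if_neg (by simpa using hi)] at h₅
        split_ifs at h₅
        have h₇ : g (i + 1) (j + 2) = 1 := by
          simp only [h₂, h₃, h₄] at h₆
          tauto
        rw [h₇]
        cases _ : (mark g j (i + 1)).isGuard || (mark g (j + 1) i).isGuard ||
          (mark g (j + 1) (i + 2)).isGuard <;> simp
    · simp only [Mark.cost]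
      exact (h₁.1 h₅).ge

theorem mark_periodic (h : IsUnrolled n g) (j : ℕ) : mark g (j + n) = mark g j := by
  funext i
  have : ∀ i, g i (j + n + 1) = g i (j + 1) := fun i => by
    rw [← h.periodic i (j + 1)]; congr 1; omega
  rcases i with _ | i
  · rfl
  · simp only [mark, this, h.periodic]

theorem columnWeight_periodic (h : IsUnrolled n g) (j : ℕ) :
    columnWeight g (j + n) = columnWeight g j := by
  simp only [columnWeight, h.periodic]

theorem sum_columnWeight (h : IsUnrolled n g) (k : ℕ) :
    ∑ j ∈ range n, columnWeight g (k + j) = ∑ j ∈ range n, columnWeight g j := by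
  induction k with
  | zero => simp
  | succ k ih =>
    rw [← ih]
    have h₁ := sum_range_succ (fun j => columnWeight g (k + j)) n
    rw [sum_range_succ', h.columnWeight_periodic, add_zero] at h₁
    simpa [add_assoc, add_comm 1] using h₁

theorem mirror (h : IsUnrolled n g) : IsUnrolled n fun i j => g (9 - i) j where
  border i j hi := h.border _ _ (by omega)
  le_two i j := h.le_two _ _
  dominated i j hi h0 := by
    have := h.dominated (9 - (i + 2)) j (by omega)
    rw [show 9 - (i + 2) + 1 = 9 - (i + 1) by omega, show 9 - (i + 2) + 2 = 9 - i by omega] at this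
    have := this h0
    tauto
  periodic i j := h.periodic _ _

theorem mark_mirror (g : ℕ → ℕ → ℕ) (j : ℕ) :
    mark (fun i j => g (9 - i) j) j = fun i => mark g j (9 - i) := by
  funext i
  rcases i with _ | i
  · rfl
  · by_cases hi : 8 ≤ i
    · rw [show 9 - (i + 1) = 0 by omega]
      simp [mark, hi]
    · rw [show 9 - (i + 1) = (9 - (i + 2)) + 1 by omega]
      have h₁ : ¬ 8 ≤ 9 - (i + 2) := by omega
      simp only [mark, if_neg hi, if_neg h₁]
      rw [show 9 - (i + 2) + 1 = 9 - (i + 1) by omega, show 9 - (i + 2) + 2 = 9 - i by omega]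
      simp only [or_left_comm]

theorem columnWeight_mirror (j : ℕ) : columnWeight (fun i j => g (9 - i) j) j = columnWeight g j := by
  rw [columnWeight, columnWeight, ← sum_range_reflect]
  refine sum_congr rfl fun i hi => ?_
  rw [mem_range] at hi
  congr 1
  omega

theorem excess_of_mark_eq_hub (h : IsUnrolled n g) {k : ℕ} (hk : mark g k = hub) :
    18 * n + 8 ≤ 5 * ∑ j ∈ range n, columnWeight g j ∨
      n % 5 = 0 ∧ 18 * n ≤ 5 * ∑ j ∈ range n, columnWeight g j ∨
      n % 5 = 3 ∧ 18 * n + 6 ≤ 5 * ∑ j ∈ range n, columnWeight g j := by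
  have := excess_of_hub (c := fun j => mark g (k + j)) (w := fun j => columnWeight g (k + 2 + j))
    (fun j => by
      rw [show k + 2 + j = k + j + 2 by omega]
      exact h.transition (k + j)) hk (hk ▸ fun i => h.compat_mark i k) (n := n)
    ((h.mark_periodic k).trans hk)
  rwa [h.sum_columnWeight] at this

/-- Either the walk avoids both missing columns, or it meets one of them; reflecting the rows turns
the mirrored hub into `hub` and preserves the weight. -/
theorem weight_ge (h : IsUnrolled n g) :
    15 * n ≤ 4 * ∑ j ∈ range n, columnWeight g j ∨
      18 * n + 8 ≤ 5 * ∑ j ∈ range n, columnWeight g j ∨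
      n % 5 = 0 ∧ 18 * n ≤ 5 * ∑ j ∈ range n, columnWeight g j ∨
      n % 5 = 3 ∧ 18 * n + 6 ≤ 5 * ∑ j ∈ range n, columnWeight g j := by
  by_cases hk : ∀ k, avoidingPotential.entry (mark g k) ≠ 0
  · left
    have := fifteen_mul_le (fun j => h.transition j) hk (n := n)
      (by simpa using h.mark_periodic 0)
    simpa only [add_comm _ 2, h.sum_columnWeight] using this
  · right
    push Not at hk
    obtain ⟨k, hk⟩ := hk
    rcases eq_hub_of_avoidingPotential_entry_eq_zero rfl
      (fun i hi => by
        obtain ⟨i, rfl⟩ := Nat.exists_eq_add_of_le' (show 1 ≤ i by omega)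
        exact if_pos (by omega)) (fun i => h.compat_mark i k) hk with hk | hk
    · exact h.excess_of_mark_eq_hub hk
    · have := h.mirror.excess_of_mark_eq_hub (k := k) (by
        rw [mark_mirror, hk]
        funext i
        change hub (9 - (9 - i)) = hub i
        by_cases hi : i ≤ 9
        · rw [Nat.sub_sub_self hi]
        · rw [show 9 - i = 0 by omega, hub_of_nine_le (i := i) (by omega)]
          rfl)
      simpa only [columnWeight_mirror] using this

/-! ### Row sums for cycles of length 3 and 4 -/

/-- A row of sum at most 1 contains no 2, so each of its zeros is dominated from the row above or
below; a cell of value 1 contributes 2 through the doubled middle sum. -/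
theorem row_three {g : ℕ → ℕ → ℕ} (h : IsUnrolled 3 g) {i : ℕ} (hi : i < 8) :
    6 ≤ ∑ j ∈ range 3, g i j + 2 * ∑ j ∈ range 3, g (i + 1) j + ∑ j ∈ range 3, g (i + 2) j ∨
      2 ≤ ∑ j ∈ range 3, g (i + 1) j := by
  have p := fun i => h.periodic i 0
  have p' := fun i => h.periodic i 1
  have d₀ := h.dominated i 0 hi
  have d₁ := h.dominated i 1 hi
  have d₂ := h.dominated i 2 hi
  simp only [zero_add, Nat.reduceAdd, p, p'] at p p' d₀ d₁ d₂
  simp only [sum_range_succ, range_zero, sum_empty]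
  generalize g i 0 = a₀, g i 1 = a₁, g i 2 = a₂, g (i + 1) 0 = b₀, g (i + 1) 1 = b₁,
    g (i + 1) 2 = b₂, g (i + 2) 0 = c₀, g (i + 2) 1 = c₁, g (i + 2) 2 = c₂ at *
  omega

theorem row_four {g : ℕ → ℕ → ℕ} (h : IsUnrolled 4 g) {i : ℕ} (hi : i < 8) :
    8 ≤ ∑ j ∈ range 4, g i j + 2 * ∑ j ∈ range 4, g (i + 1) j + ∑ j ∈ range 4, g (i + 2) j ∨
      2 ≤ ∑ j ∈ range 4, g (i + 1) j := by
  have p := fun i => h.periodic i 0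
  have p' := fun i => h.periodic i 1
  have d₀ := h.dominated i 0 hi
  have d₁ := h.dominated i 1 hi
  have d₂ := h.dominated i 2 hi
  have d₃ := h.dominated i 3 hi
  simp only [zero_add, Nat.reduceAdd, p, p'] at p p' d₀ d₁ d₂ d₃
  simp only [sum_range_succ, range_zero, sum_empty]
  generalize g i 0 = a₀, g i 1 = a₁, g i 2 = a₂, g i 3 = a₃, g (i + 1) 0 = b₀, g (i + 1) 1 = b₁,
    g (i + 1) 2 = b₂, g (i + 1) 3 = b₃, g (i + 2) 0 = c₀, g (i + 2) 1 = c₁, g (i + 2) 2 = c₂,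
    g (i + 2) 3 = c₃ at *
  omega

theorem sum_columnWeight_eq (n : ℕ) (g : ℕ → ℕ → ℕ) : ∑ j ∈ range n, columnWeight g j =
    ∑ i ∈ range 8, ∑ j ∈ range n, g (i + 1) j := sum_comm

theorem sum_row_eq_zero {n : ℕ} {g : ℕ → ℕ → ℕ} (h : IsUnrolled n g) {i : ℕ} (hi : i = 0 ∨ 9 ≤ i) :
    ∑ j ∈ range n, g i j = 0 := sum_eq_zero fun j _ => h.border i j hi

/-- The general bound 15n/4 yields only 12 here, and only 15 for n = 4. -/
theorem thirteen_le {g : ℕ → ℕ → ℕ} (h : IsUnrolled 3 g) :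
    13 ≤ ∑ j ∈ range 3, columnWeight g j := by
  have h₀ := h.sum_row_eq_zero (.inl rfl)
  have h₉ := h.sum_row_eq_zero (.inr le_rfl)
  have h' := fun i => h.row_three (i := i)
  rw [sum_columnWeight_eq]
  generalize (fun i => ∑ j ∈ range 3, g i j) = R at *
  have a₀ := h' 0 (by simp)
  have a₁ := h' 1 (by simp)
  have a₂ := h' 2 (by simp)
  have a₃ := h' 3 (by simp)
  have a₄ := h' 4 (by simp)
  have a₅ := h' 5 (by simp)
  have a₆ := h' 6 (by simp)
  have a₇ := h' 7 (by simp)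
  rw [sum_range_succ, sum_range_succ, sum_range_succ, sum_range_succ, sum_range_succ,
    sum_range_succ, sum_range_succ, sum_range_succ, sum_range_zero]
  simp only [zero_add, Nat.reduceAdd] at *
  omega

theorem sixteen_le {g : ℕ → ℕ → ℕ} (h : IsUnrolled 4 g) :
    16 ≤ ∑ j ∈ range 4, columnWeight g j := by
  have h₀ := h.sum_row_eq_zero (.inl rfl)
  have h₉ := h.sum_row_eq_zero (.inr le_rfl)
  have h' := fun i => h.row_four (i := i)
  rw [sum_columnWeight_eq]
  have a₀ := h' 0 (by simp)
  have a₁ := h' 1 (by simp)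
  have a₂ := h' 2 (by simp)
  have a₃ := h' 3 (by simp)
  have a₄ := h' 4 (by simp)
  have a₅ := h' 5 (by simp)
  have a₆ := h' 6 (by simp)
  have a₇ := h' 7 (by simp)
  rw [sum_range_succ, sum_range_succ, sum_range_succ, sum_range_succ, sum_range_succ,
    sum_range_succ, sum_range_succ, sum_range_succ, sum_range_zero]
  simp only [zero_add, Nat.reduceAdd] at *
  omega

theorem le_weight {n : ℕ} {g : ℕ → ℕ → ℕ} (h : IsUnrolled n g) (hn : 3 ≤ n) :
    (if n % 5 = 0 then (18 * n + 4) / 5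
      else if ((n % 5 = 2 ∨ n % 5 = 3 ∨ n % 5 = 4) ∧ n ≠ 3) ∨ n = 6 then (18 * n + 4) / 5 + 1
      else (18 * n + 4) / 5 + 2) ≤ ∑ j ∈ range n, columnWeight g j := by
  have h₁ := h.weight_ge
  rcases hn.eq_or_lt with rfl | hn
  · exact h.thirteen_le
  rcases (Nat.succ_le_of_lt hn).eq_or_lt with rfl | hn
  · exact h.sixteen_le
  generalize ∑ j ∈ range n, columnWeight g j = W at *
  clear h
  split_ifs <;> omega

end IsUnrolled

/-! ### Unrolling the cylinder -/

open SimpleGraph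

theorem eq_add_one_mod {n a b : ℕ} (ha : a < n) (hb : b < n) (h : (n - a + b) % n = 1) :
    b = (a + 1) % n := by
  have key : ∀ m < 2 * n, m % n = if m < n then m else m - n := by
    intro m hm
    split_ifs with h'
    · exact Nat.mod_eq_of_lt h'
    · rw [Nat.mod_eq_sub_mod (by omega), Nat.mod_eq_of_lt (by omega)]
  rw [key _ (by omega)] at h ⊢
  split_ifs at * <;> omega

/-- The values of a function on the cylinder, as a function on the universal cover. -/
def unroll {n : ℕ} (hn : 0 < n) (f : Fin 8 × Fin n → Fin 3) : ℕ → ℕ → ℕ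
  | 0, _ => 0
  | i + 1, j => if h : i < 8 then f (⟨i, h⟩, ⟨j % n, Nat.mod_lt j hn⟩) else 0

theorem isUnrolled_unroll {n : ℕ} (hn : 0 < n) {f : Fin 8 × Fin n → Fin 3}
    (hf : (pathGraph 8 □ cycleGraph n).IsRomanDominating f) : IsUnrolled n (unroll hn f) where
  border i j hi := by
    rcases i with _ | i
    · rfl
    · exact dif_neg (by omega)
  le_two i j := by
    rcases i with _ | i
    · exact Nat.zero_le _
    · simp only [unroll]
      split_ifs <;> omega
  periodic i j := by
    rcases i with _ | i
    · rfl
    · simp only [unroll, Nat.add_mod_right]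
  dominated i j hi h0 := by
    have hval : ∀ (a : Fin 8) (b : Fin n) (k : ℕ), k % n = b → f (a, b) = 2 →
        unroll hn f (a + 1) k = 2 := by
      intro a b k hk h
      simp only [unroll, a.isLt, dif_pos, hk]
      rw [show ((⟨a, a.isLt⟩, ⟨b, b.isLt⟩) : Fin 8 × Fin n) = (a, b) from rfl, h]
      rfl
    simp only [unroll, hi, dif_pos, Fin.val_eq_zero_iff] at h0
    obtain ⟨⟨a, b⟩, hadj, hw⟩ := hf _ h0
    rw [boxProd_adj] at hadj
    rcases hadj with ⟨h, hb⟩ | ⟨h, ha⟩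
    · rw [pathGraph_adj] at h
      have := hval a b (j + 1) (by simp only at hb; rw [← hb]) hw
      simp only at h
      rcases h with h | h
      · right; left
        rwa [← h] at this
      · left
        rwa [h] at this
    · simp only at ha
      subst ha
      rw [cycleGraph_adj'] at h
      simp only [Fin.val_sub] at h
      have hj := Nat.mod_lt (j + 1) hn
      rcases h with h | h
      · right; right; left
        refine hval _ b j ?_ hw
        have : j + 1 ≡ b + 1 [MOD n] := eq_add_one_mod b.isLt hj h
        exact Eq.trans (this.add_right_cancel' 1) (Nat.mod_eq_of_lt b.isLt)
      · right; right; right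
        refine hval _ b (j + 2) ?_ hw
        rw [eq_add_one_mod hj b.isLt h, Nat.mod_add_mod]

theorem sum_columnWeight_unroll {n : ℕ} (hn : 0 < n) (f : Fin 8 × Fin n → Fin 3) :
    ∑ j ∈ range n, columnWeight (unroll hn f) j = romanWeight f := by
  rw [romanWeight, Fintype.sum_prod_type_right, sum_range]
  refine Fintype.sum_congr _ _ fun j => ?_
  rw [columnWeight, sum_range]
  refine Fintype.sum_congr _ _ fun i => ?_
  simp [unroll, Nat.mod_eq_of_lt]

/-! ### Upper bound by explicit words -/

/-- The columns `l`, `c`, `r` are consecutive, and all zeros of `c` are dominated. -/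
def IsDominated (l c r : Fin 8 → Fin 3) : Prop :=
  ∀ i, c i = 0 → l i = 2 ∨ r i = 2 ∨ ∃ i' : Fin 8, (i.val + 1 = i'.val ∨ i'.val + 1 = i.val) ∧
    c i' = 2

/-- The columns `a` and `b` have the value `2` in the same rows. -/
def SameGuards (a b : Fin 8 → Fin 3) : Prop := ∀ i, a i = 2 ↔ b i = 2

instance (l c r : Fin 8 → Fin 3) : Decidable (IsDominated l c r) := by
  unfold IsDominated; infer_instance

instance (a b : Fin 8 → Fin 3) : Decidable (SameGuards a b) := by
  unfold SameGuards; infer_instance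

/-- Neighbouring columns matter only through the positions of their 2s; this lets words be spliced
whose end columns differ in their 1s. -/
theorem IsDominated.congr {l c r l' r' : Fin 8 → Fin 3} (h : IsDominated l c r)
    (hl : SameGuards l l') (hr : SameGuards r r') : IsDominated l' c r' := by
  intro i hi
  rw [← hl i, ← hr i]
  exact h i hi

/-- The columns `c 0, …, c (n - 1)` form a Roman dominating function on the cylinder. -/
def IsClosedWord (n : ℕ) (c : ℕ → Fin 8 → Fin 3) : Prop :=
  ∀ j < n, IsDominated (c ((j + (n - 1)) % n)) (c j) (c ((j + 1) % n))

instance (n : ℕ) (c : ℕ → Fin 8 → Fin 3) : Decidable (IsClosedWord n c) := by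
  unfold IsClosedWord; infer_instance

def wordWeight (n : ℕ) (c : ℕ → Fin 8 → Fin 3) : ℕ := ∑ j ∈ range n, ∑ i, (c j i : ℕ)

theorem IsClosedWord.romanDominationNumber_le {n : ℕ} (hn : 2 ≤ n) {c : ℕ → Fin 8 → Fin 3}
    (h : IsClosedWord n c) :
    (pathGraph 8 □ cycleGraph n).romanDominationNumber ≤ wordWeight n c := by
  refine (isLeast_romanDominationNumber _).2 ⟨fun x => c x.2 x.1, ?_, ?_⟩
  · rintro ⟨i, j⟩ hij
    have hadj : ∀ a < n, (n - a + (a + 1) % n) % n = 1 := by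
      intro a ha
      rw [Nat.add_mod_mod, show n - a + (a + 1) = 1 + n by omega, Nat.add_mod_right,
        Nat.mod_eq_of_lt (by omega)]
    have hpos : 0 < n := by omega
    rcases h j j.isLt i hij with h | h | ⟨i', hi', h⟩
    · refine ⟨(i, ⟨(j + (n - 1)) % n, Nat.mod_lt _ hpos⟩), ?_, h⟩
      rw [boxProd_adj, cycleGraph_adj', Fin.val_sub]
      refine Or.inr ⟨Or.inl ?_, rfl⟩
      have := hadj _ (Nat.mod_lt (j + (n - 1)) hpos)
      rwa [Nat.mod_add_mod, show j + (n - 1) + 1 = j + n by omega, Nat.add_mod_right,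
        Nat.mod_eq_of_lt j.isLt] at this
    · refine ⟨(i, ⟨(j + 1) % n, Nat.mod_lt _ hpos⟩), ?_, h⟩
      rw [boxProd_adj, cycleGraph_adj', Fin.val_sub, Fin.val_sub]
      exact Or.inr ⟨Or.inr (hadj j j.isLt), rfl⟩
    · refine ⟨(i', j), ?_, h⟩
      rw [boxProd_adj, pathGraph_adj]
      exact Or.inl ⟨hi', rfl⟩
  · rw [romanWeight, Fintype.sum_prod_type_right, wordWeight, sum_range]

/-- The column whose values are the eight decimal digits of `N`. -/
def digitColumn (N : ℕ) (i : Fin 8) : Fin 3 := Fin.ofNat 3 (N / 10 ^ (7 - i.val) % 10)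

def digitWord (l : List ℕ) (j : ℕ) : Fin 8 → Fin 3 := digitColumn (l.getD j 0)

/-- The optimal pattern of period `5`. -/
def block : ℕ → Fin 8 → Fin 3 := digitWord [02000020, 10002000, 00200002, 20000200, 00020001]

/-- The word consisting of `k` blocks, followed by `c`. -/
def prependBlocks (k : ℕ) (c : ℕ → Fin 8 → Fin 3) (j : ℕ) : Fin 8 → Fin 3 :=
  if j < 5 * k then block (j % 5) else c (j - 5 * k)

theorem isClosedWord_block : IsClosedWord 5 block := by decide +kernel

theorem SameGuards.refl (a : Fin 8 → Fin 3) : SameGuards a a := fun _ => Iff.rfl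

theorem SameGuards.symm {a b : Fin 8 → Fin 3} (h : SameGuards a b) : SameGuards b a :=
  fun i => (h i).symm

/-- At both seams the neighbouring column is replaced by one with the same guards: the word starts
like `block 0` and ends like `block 4`, just as the next or previous block would. -/
theorem IsClosedWord.prependBlocks {m : ℕ} {c : ℕ → Fin 8 → Fin 3} (hm : 0 < m)
    (h : IsClosedWord m c) (h₀ : SameGuards (c 0) (block 0))
    (h₁ : SameGuards (c (m - 1)) (block 4)) (k : ℕ) :
    IsClosedWord (5 * k + m) (prependBlocks k c) := by
  have hc : ∀ i, RomanCylinder.prependBlocks k c (5 * k + i) = c i := fun i => by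
    rw [RomanCylinder.prependBlocks, if_neg (by omega), Nat.add_sub_cancel_left]
  have hb : ∀ j < 5 * k, RomanCylinder.prependBlocks k c j = block (j % 5) := fun j hj => if_pos hj
  have hstart : SameGuards (c 0) (RomanCylinder.prependBlocks k c 0) := by
    rcases k.eq_zero_or_pos with rfl | hk
    · exact .refl _
    · rwa [hb 0 (by omega)]
  intro j hj
  rcases lt_or_ge j (5 * k) with hjk | hjk
  · rw [hb j hjk]
    refine (isClosedWord_block (j % 5) (Nat.mod_lt _ (by simp))).congr ?_ ?_
    · rcases j with _ | j
      · rw [Nat.mod_eq_of_lt (show 0 + (5 * k + m - 1) < 5 * k + m by omega),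
          show 0 + (5 * k + m - 1) = 5 * k + (m - 1) by omega, hc]
        exact h₁.symm
      · rw [show j + 1 + (5 * k + m - 1) = j + (5 * k + m) by omega, Nat.add_mod_right,
          Nat.mod_eq_of_lt (show j < 5 * k + m by omega), hb _ (by omega), Nat.mod_add_mod,
          show j + 1 + (5 - 1) = j + 5 by omega, Nat.add_mod_right]
        exact .refl _
    · rw [Nat.mod_eq_of_lt (show j + 1 < 5 * k + m by omega), Nat.mod_add_mod]
      rcases (Nat.succ_le_of_lt hjk).eq_or_lt with hjk | hjk
      · rw [show j + 1 = 5 * k + 0 from hjk, hc, add_zero, Nat.mul_mod_right]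
        exact h₀.symm
      · rw [hb _ hjk]
        exact .refl _
  · obtain ⟨i, rfl⟩ := Nat.exists_eq_add_of_le hjk
    rw [hc]
    refine (h i (by omega)).congr ?_ ?_
    · rcases i with _ | i
      · rw [zero_add, Nat.mod_eq_of_lt (by omega)]
        rcases k.eq_zero_or_pos with rfl | hk
        · have : (5 * 0 + 0 + (5 * 0 + m - 1)) % (5 * 0 + m) = 5 * 0 + (m - 1) := by
            rw [Nat.mod_eq_of_lt (by omega)]; omega
          rw [this, hc]
          exact .refl _
        · rw [show 5 * k + 0 + (5 * k + m - 1) = 5 * k - 1 + (5 * k + m) by omega,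
            Nat.add_mod_right, Nat.mod_eq_of_lt (by omega), hb _ (by omega),
            show (5 * k - 1) % 5 = 4 by omega]
          exact h₁
      · rw [show i + 1 + (m - 1) = i + m by omega, Nat.add_mod_right, Nat.mod_eq_of_lt (by omega),
          show 5 * k + (i + 1) + (5 * k + m - 1) = 5 * k + i + (5 * k + m) by omega,
          Nat.add_mod_right, Nat.mod_eq_of_lt (by omega), hc]
        exact .refl _
    · rcases (show i + 1 ≤ m by omega).eq_or_lt with him | him
      · rw [add_assoc, him, Nat.mod_self, Nat.mod_self]
        exact hstart
      · rw [add_assoc, Nat.mod_eq_of_lt him, Nat.mod_eq_of_lt (by omega), hc]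
        exact .refl _

theorem wordWeight_prependBlocks (m : ℕ) (c : ℕ → Fin 8 → Fin 3) (k : ℕ) :
    wordWeight (5 * k + m) (prependBlocks k c) = 18 * k + wordWeight m c := by
  have h : ∀ k, ∑ j ∈ range (5 * k), ∑ i, (block (j % 5) i : ℕ) = 18 * k := by
    intro k
    induction k with
    | zero => rfl
    | succ k ih =>
      have h5 : ∑ j ∈ range 5, ∑ i, (block j i : ℕ) = 18 := by decide +kernel
      rw [mul_add, mul_one, sum_range_add, ih, mul_add, mul_one, ← h5]
      congr 1
      refine sum_congr rfl fun j hj => ?_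
      rw [Nat.mul_add_mod, Nat.mod_eq_of_lt (mem_range.1 hj)]
  rw [wordWeight, sum_range_add, ← h k]
  congr 1
  · refine sum_congr rfl fun j hj => ?_
    rw [prependBlocks, if_pos (mem_range.1 hj)]
  · refine sum_congr rfl fun j hj => ?_
    rw [prependBlocks, if_neg (by omega), Nat.add_sub_cancel_left]

theorem romanDominationNumber_le_of_word {l : List ℕ} {w : ℕ} (hl : 2 ≤ l.length)
    (h : IsClosedWord l.length (digitWord l) ∧ wordWeight l.length (digitWord l) = w) :
    (pathGraph 8 □ cycleGraph l.length).romanDominationNumber ≤ w :=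
  h.2 ▸ h.1.romanDominationNumber_le hl

theorem romanDominationNumber_le_of_word_add {l : List ℕ} {w : ℕ} (hl : 2 ≤ l.length)
    (h : IsClosedWord l.length (digitWord l) ∧ SameGuards (digitWord l 0) (block 0) ∧
      SameGuards (digitWord l (l.length - 1)) (block 4) ∧
      wordWeight l.length (digitWord l) = w) (k : ℕ) :
    (pathGraph 8 □ cycleGraph (5 * k + l.length)).romanDominationNumber ≤ 18 * k + w := by
  rw [← h.2.2.2, ← wordWeight_prependBlocks]
  exact (h.1.prependBlocks (by omega) h.2.1 h.2.2.1 k).romanDominationNumber_le (by omega)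

theorem romanDominationNumber_le {n : ℕ} (hn : 3 ≤ n) :
    (pathGraph 8 □ cycleGraph n).romanDominationNumber ≤
      if n % 5 = 0 then (18 * n + 4) / 5
      else if ((n % 5 = 2 ∨ n % 5 = 3 ∨ n % 5 = 4) ∧ n ≠ 3) ∨ n = 6 then (18 * n + 4) / 5 + 1
      else (18 * n + 4) / 5 + 2 := by
  -- One extendable word per residue class. Residue 1 starts at 11: prepending blocks to a word of
  -- length 6 and weight 23 would beat the lower bound for n = 5k + 6, k ≥ 1.
  have key : n = 3 ∨ n = 6 ∨ ∃ k, n = 5 * k + 4 ∨ n = 5 * k + 5 ∨ n = 5 * k + 7 ∨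
      n = 5 * k + 8 ∨ n = 5 * k + 11 := by
    have h := Nat.div_add_mod n 5
    have := Nat.mod_lt n (show 5 > 0 by simp)
    by_cases h3 : n = 3
    · exact .inl h3
    by_cases h6 : n = 6
    · exact .inr (.inl h6)
    right; right
    obtain h' | h' : n % 5 = 4 ∨ n % 5 ≠ 4 := em _
    · exact ⟨n / 5, by omega⟩
    obtain h' | h' : n % 5 = 1 ∨ n % 5 ≠ 1 := em _
    · exact ⟨n / 5 - 2, by omega⟩
    · exact ⟨n / 5 - 1, by omega⟩
  rcases key with rfl | rfl | ⟨k, rfl | rfl | rfl | rfl | rfl⟩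
  · exact romanDominationNumber_le_of_word (l := [00200002, 20010200, 01002010]) (by decide)
      (by decide +kernel)
  · exact romanDominationNumber_le_of_word
      (l := [02000202, 00020000, 20000020, 00202001, 20000020, 00020000]) (by decide)
      (by decide +kernel)
  · refine (romanDominationNumber_le_of_word_add (w := 16)
      (l := [02000020, 00002000, 20200102, 00020100]) (by decide) (by decide +kernel) k).trans ?_
    split_ifs <;> omega
  · refine (romanDominationNumber_le_of_word_add (w := 18)
      (l := [02000020, 10002000, 00200002, 20000200, 00020001]) (by decide)
      (by decide +kernel) k).trans ?_
    split_ifs <;> omega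
  · refine (romanDominationNumber_le_of_word_add (w := 27)
      (l := [02000020, 00002001, 20200020, 01002000, 00200002, 20000200, 00020001]) (by decide)
      (by decide +kernel) k).trans ?_
    split_ifs <;> omega
  · refine (romanDominationNumber_le_of_word_add (w := 30)
      (l := [02000020, 00002000, 20200102, 00002000, 02000020, 00020000, 20100202, 00020000])
      (by decide) (by decide +kernel) k).trans ?_
    split_ifs <;> omega
  · refine (romanDominationNumber_le_of_word_add (w := 42)
      (l := [02000020, 10002000, 00200002, 20000200, 00020001, 02000020, 10002000, 00200002,
        20000200, 01020002, 10020100]) (by decide) (by decide +kernel) k).trans ?_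
    split_ifs <;> omega

end RomanCylinder

/-! ### Conclusion -/

theorem mainTheorem4 (n : ℕ) (hn : 3 ≤ n) :
    (SimpleGraph.pathGraph 8 □ SimpleGraph.cycleGraph n).romanDominationNumber =
      if n ≡ 0 [MOD 5] then ⌈(18 * n : ℚ) / 5⌉₊
      else if ((n ≡ 2 [MOD 5] ∨ n ≡ 3 [MOD 5] ∨ n ≡ 4 [MOD 5]) ∧ n ≠ 3) ∨ n = 6 then
        ⌈(18 * n : ℚ) / 5⌉₊ + 1
      else ⌈(18 * n : ℚ) / 5⌉₊ + 2 := by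
  have hceil : ⌈(18 * n : ℚ) / 5⌉₊ = (18 * n + 4) / 5 := by
    refine eq_of_forall_ge_iff fun c => ?_
    rw [Nat.ceil_le, div_le_iff₀ (by norm_num)]
    have : (18 * n : ℚ) ≤ c * 5 ↔ 18 * n ≤ c * 5 := by exact_mod_cast Iff.rfl
    rw [this]
    omega
  rw [hceil]
  refine le_antisymm (RomanCylinder.romanDominationNumber_le hn) ?_
  obtain ⟨f, hf, hw⟩ := (SimpleGraph.isLeast_romanDominationNumber
    (SimpleGraph.pathGraph 8 □ SimpleGraph.cycleGraph n)).1
  have hpos : 0 < n := by omega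
  rw [← hw, ← RomanCylinder.sum_columnWeight_unroll hpos f]
  exact (RomanCylinder.isUnrolled_unroll hpos hf).le_weight hn
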